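/- Let $n \ge 1$, and let $S_n$ be the set of permutations of $\{1,\dots,n\}$, each written as the word $\pi(1)\pi(2)\cdots\pi(n)$. The runs of a word are its maximal contiguous (weakly) increasing subwords, and $\mathrm{runsort}(\pi)$ denotes the word obtained from $\pi$ by rearranging its runs in lexicographic order; it is again a permutation in $S_n$. Let $\mathrm{RS}(\pi)$ be the set of values that appear first in a run of $\pi$. Let $\mathrm{PKV}(\pi)$ be the set of peak-values of $\pi$, that is, the set of all $\pi(i)$ with $1<i<n$ and $\pi(i-1)<\pi(i)>\pi(i+1)$, and put $\mathrm{SPV}(\pi) = \mathrm{PKV}(\mathrm{runsort}(\pi))$. For indeterminates $x_1,x_2,\dots$ and $y_1,y_2,\dots$ and a finite set $T$ of positive integers write $\mathbf{x}_T=\prod_{t\in T}x_t$ and $\mathbf{y}_T=\prod_{t\in T}y_t$. Then $$\sum_{\pi\in S_n}\mathbf{x}_{\mathrm{RS}(\pi)}\,\mathbf{y}_{\mathrm{PKV}(\pi)}=\sum_{\pi\in S_n}\mathbf{x}_{\mathrm{RS}(\pi)}\,\mathbf{y}_{\mathrm{SPV}(\pi)}.$$ In particular, $$\sum_{\sigma\in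 S_n}\mathbf{x}_{\mathrm{PKV}(\sigma)}=\sum_{\tau\in S_n}\mathbf{x}_{\mathrm{SPV}(\tau)}.$$ -/

import Mathlib

namespace RunSort

/-- The one-line notation `π(1) π(2) ⋯ π(n)` of a permutation of `{1, …, n}`, as a word with
letters in `{1, …, n}`. Permutations of `{1, …, n}` are modelled by permutations of `Fin n`, with
the element `i` of `Fin n` standing for the integer `i + 1`. -/
def oneLine {n : ℕ} (π : Equiv.Perm (Fin n)) : List ℕ :=
  List.ofFn fun i => (π i : ℕ) + 1

/-- The runs of a word, in order of appearance: the maximal contiguous weakly increasing subwords,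
obtained by cutting the word exactly at its descents. -/
def runs (w : List ℕ) : List (List ℕ) :=
  w.splitBy fun a b => decide (a ≤ b)

/-- The word obtained by rearranging the runs of `w` in (weakly increasing) lexicographic order. -/
def runsort (w : List ℕ) : List ℕ :=
  ((runs w).insertionSort (· ≤ ·)).flatten

/-- The set of values appearing first in a run of the word. -/
def runStarts (w : List ℕ) : Finset ℕ :=
  ((runs w).filterMap List.head?).toFinset

/-- The set of peak-values of a word: the letters with both a letter immediately to the left and
a letter immediately to the right, and strictly larger than these two. Positions are counted
from `0`. -/
def peakValues (w : List ℕ) : Finset ℕ :=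
  ((Finset.range w.length).filter fun i =>
      0 < i ∧ i + 1 < w.length ∧
        w.getD (i - 1) 0 < w.getD i 0 ∧ w.getD (i + 1) 0 < w.getD i 0).image
    fun i => w.getD i 0

/-- `RS(π)`: the set of run-starts of a permutation. -/
def RS {n : ℕ} (π : Equiv.Perm (Fin n)) : Finset ℕ :=
  runStarts (oneLine π)

/-- `PKV(π)`: the set of peak-values of a permutation. -/
def PKV {n : ℕ} (π : Equiv.Perm (Fin n)) : Finset ℕ :=
  peakValues (oneLine π)

/-- `SPV(π) = PKV(runsort(π))`: the set of peak-values after run-sorting. -/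
def SPV {n : ℕ} (π : Equiv.Perm (Fin n)) : Finset ℕ :=
  peakValues (runsort (oneLine π))

/-- The squarefree product `x_T = ∏_{t ∈ T} x_t`. -/
def setProd {R : Type*} [CommMonoid R] (x : ℕ → R) (T : Finset ℕ) : R :=
  ∏ t ∈ T, x t

/-- Run-sorting only rearranges the letters of a word; in particular the run-sort of the one-line
notation of a permutation is again the one-line notation of a permutation. -/
theorem runsort_perm (w : List ℕ) : (runsort w).Perm w := by
  have h := ((runs w).perm_insertionSort (· ≤ ·)).flatten
  have h2 : (runs w).flatten = w := List.flatten_splitBy _ _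
  rw [h2] at h
  exact h

end RunSort

/-! Build permutations by inserting `1, 2, …, n` in this order, each new largest letter at the front
or directly behind an older one. A word is recorded by its ascent predecessors (`ascPred`). Together
with a word on `1, …, m`, fix in advance the set `U` of open letters: those that will finally be
followed directly by a letter larger than `m`. Cutting behind `U` leaves exactly the parts of the
final runs with letters up to `m`, so the weights of these letters are already determined. The next
letter either starts a run, with factor `x`, or fills the place behind an open letter and continues
its run; if it closes that run, it may earn a factor `y`.

The sum over all continuations then depends only on the number of open letters and on one marked
letter. For peak-values the mark is the last letter of the word, which is treated as open forever
because it is never a peak. After run-sorting, the end `v` of a run is a peak exactly when some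
other run starts between the start of its own run and `v`. Closing a run therefore earns `y` unless
that run has the latest start so far; the mark is its largest letter `tip`, and two kernels `A`, `B`
record whether it is open or closed.

The recursion for `A + B` is the recursion for the peak kernel `V`, with the same initial value
(`kerV_eq`). Both sums equal `x 1 * kerV x y n 1 0` (`sum_peak_weight`, `sum_sorted_weight`, for
words of length `n + 1`). -/

namespace RunSort

/-! ### Weights of words cut behind open letters -/

open Finset

/-- The predecessor function after inserting the new largest letter `v` directly after `u`
(at the front when `u = 0`). -/
def insPred (r : ℕ → ℕ) (u v : ℕ) : ℕ → ℕ :=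
  fun b => if b = v then u else if r b = u then 0 else r b

/-- The predecessor function after cutting the word behind each letter of `U`. -/
def cut (r : ℕ → ℕ) (U : Finset ℕ) : ℕ → ℕ :=
  fun b => if r b ∈ U then 0 else r b

/-- The letter `a` is not in `U` and is not followed by a larger letter. -/
def Closed (r : ℕ → ℕ) (U : Finset ℕ) (a : ℕ) : Prop :=
  a ∉ U ∧ ∀ b, r b ≠ a

open scoped Classical in
/-- The weight of a letter: `x v` if it is a run-start, and `y v` if it ends a run of length at
least two and satisfies the condition `c`. -/
noncomputable def letterWeight {R : Type*} [CommSemiring R] (x y : ℕ → R)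
    (c : (ℕ → ℕ) → ℕ → Prop) (r : ℕ → ℕ) (U : Finset ℕ) (v : ℕ) : R :=
  if cut r U v = 0 then x v else if Closed r U v ∧ c (cut r U) v then y v else 1

/-- The weight of a word with letters `1, …, m`, predecessor function `r`, cut behind `U`. -/
noncomputable def weight {R : Type*} [CommSemiring R] (x y : ℕ → R)
    (c : (ℕ → ℕ) → ℕ → Prop) (m : ℕ) (r : ℕ → ℕ) (U : Finset ℕ) : R :=
  ∏ v ∈ Icc 1 m, letterWeight x y c r U v

/-- The condition `c` at `v` only depends on the predecessors of the letters up to `v`. -/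
def IsLocal (c : (ℕ → ℕ) → ℕ → Prop) : Prop :=
  ∀ f g v, (∀ b ≤ v, f b = g b) → (c f v ↔ c g v)

/-- Predecessor functions of words with letters `1, …, m`. -/
structure IsPred (m : ℕ) (r : ℕ → ℕ) : Prop where
  lt : ∀ b, r b ≠ 0 → r b < b
  le : ∀ b, r b ≠ 0 → b ≤ m

theorem IsPred.apply_le {m : ℕ} {r : ℕ → ℕ} (h : IsPred m r) (b : ℕ) : r b ≤ m := by
  by_cases hb : r b = 0
  · omega
  · have := h.lt b hb
    have := h.le b hb
    omega

theorem IsPred.apply_of_lt {m : ℕ} {r : ℕ → ℕ} (h : IsPred m r) {b : ℕ} (hb : m < b) :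
    r b = 0 := by
  by_contra h0
  have := h.le b h0
  omega

/-! ### Effect of inserting a largest letter -/

section Insertion

variable {R : Type*} [CommSemiring R] (x y : ℕ → R) {c : (ℕ → ℕ) → ℕ → Prop}
  {m u : ℕ} {r : ℕ → ℕ} {U S : Finset ℕ}

theorem zero_notMem_of_subset (hU : U ⊆ Icc 1 m) : 0 ∉ U := fun h => by
  have := mem_Icc.1 (hU h)
  omega

theorem succ_notMem_of_subset (hU : U ⊆ Icc 1 m) : m + 1 ∉ U := fun h => by
  have := mem_Icc.1 (hU h)
  omega

/-- `T` is the set of open letters before the insertion: `u` stays open in the first case and is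
filled in the second. The letter behind `u` is cut off either way, on one side by `m + 1` and on the
other by `u ∈ T`. -/
theorem cut_insPred (hr : IsPred m r) (hS : S = U ∨ S = insert (m + 1) U)
    (hU : U ⊆ Icc 1 m) {T : Finset ℕ}
    (hT : (T = U ∧ (u = 0 ∨ u ∈ U)) ∨ (T = insert u U ∧ u ≠ 0)) {b : ℕ} (hb : b ≠ m + 1) :
    cut (insPred r u (m + 1)) S b = cut r T b := by
  have h0 := zero_notMem_of_subset hU
  have h1 := hr.apply_le b
  have hmem : ∀ a, a ≤ m → (a ∈ S ↔ a ∈ U) := by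
    intro a ha
    rcases hS with rfl | rfl
    · rfl
    · rw [mem_insert]
      constructor
      · rintro (h | h)
        · omega
        · exact h
      · exact Or.inr
  unfold cut insPred
  rw [if_neg hb]
  by_cases hu : r b = u
  · rw [if_pos hu, hu]
    rcases hT with ⟨rfl, h | h⟩ | ⟨rfl, h⟩
    · simp [h]
    · simp [h]
    · simp
  · rw [if_neg hu]
    simp only [hmem _ h1]
    rcases hT with ⟨rfl, h⟩ | ⟨rfl, h⟩
    · rfl
    · simp [hu]

theorem closed_insPred (hr : IsPred m r) (hS : S = U ∨ S = insert (m + 1) U)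
    {T : Finset ℕ}
    (hT : (T = U ∧ (u = 0 ∨ u ∈ U)) ∨ (T = insert u U ∧ u ≠ 0)) {a : ℕ} (ha : a ∈ Icc 1 m) :
    Closed (insPred r u (m + 1)) S a ↔ Closed r T a := by
  rw [mem_Icc] at ha
  have hmem : a ∈ S ↔ a ∈ U := by
    rcases hS with rfl | rfl
    · rfl
    · rw [mem_insert]
      constructor
      · rintro (h | h)
        · omega
        · exact h
      · exact Or.inr
  unfold Closed
  rw [hmem]
  have key : a ≠ u → ((∀ b, insPred r u (m + 1) b ≠ a) ↔ ∀ b, r b ≠ a) := by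
    intro hau
    refine forall_congr' fun b => ?_
    unfold insPred
    split_ifs with h1 h2
    · subst h1
      rw [hr.apply_of_lt (Nat.lt_succ_self m)]
      simp only [ne_eq]
      constructor <;> intro <;> omega
    · rw [h2]
      constructor <;> intro <;> omega
    · rfl
  by_cases hau : a = u
  · subst hau
    rcases hT with ⟨rfl, h | h⟩ | ⟨rfl, h⟩
    · omega
    · simp [h]
    · simp only [mem_insert_self, not_true_eq_false, false_and, iff_false, not_and, not_forall]
      intro _
      exact ⟨m + 1, by simp [insPred]⟩
  · rw [key hau]
    rcases hT with ⟨rfl, h⟩ | ⟨rfl, h⟩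
    · rfl
    · simp [hau]

/-- By locality the factors of the old letters see only `cut r T`, so the insertion contributes just
the factor of `m + 1`. -/
theorem weight_insPred (hc : IsLocal c) (hr : IsPred m r) (hS : S = U ∨ S = insert (m + 1) U)
    (hU : U ⊆ Icc 1 m) {T : Finset ℕ}
    (hT : (T = U ∧ (u = 0 ∨ u ∈ U)) ∨ (T = insert u U ∧ u ≠ 0)) :
    weight x y c (m + 1) (insPred r u (m + 1)) S =
      weight x y c m r T * letterWeight x y c (insPred r u (m + 1)) S (m + 1) := by
  unfold weight
  rw [Finset.prod_Icc_succ_top (by omega)]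
  congr 1
  refine Finset.prod_congr rfl fun v hv => ?_
  have hv' := mem_Icc.1 hv
  unfold letterWeight
  rw [cut_insPred hr hS hU hT (by omega), closed_insPred hr hS hT hv,
    hc _ (cut r T) v fun b hb => cut_insPred hr hS hU hT (by omega)]

theorem letterWeight_insPred_start (hS : S = U ∨ S = insert (m + 1) U)
    (hu : u = 0 ∨ u ∈ U) :
    letterWeight x y c (insPred r u (m + 1)) S (m + 1) = x (m + 1) := by
  unfold letterWeight
  rw [if_pos]
  simp only [cut, insPred, if_true]
  rcases hu with rfl | hu
  · simp
  · rw [if_pos]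
    rcases hS with rfl | rfl
    · exact hu
    · exact mem_insert_of_mem hu

theorem cut_insPred_self (hS : S = U ∨ S = insert (m + 1) U) (hum : u ≤ m) (hu : u ∉ U) :
    cut (insPred r u (m + 1)) S (m + 1) = u := by
  simp only [cut, insPred, if_true]
  rw [if_neg]
  rcases hS with rfl | rfl
  · exact hu
  · rw [mem_insert]
    rintro (h | h)
    · omega
    · exact hu h

theorem letterWeight_insPred_open (hum : u ≤ m) (hu0 : u ≠ 0) (hu : u ∉ U) :
    letterWeight x y c (insPred r u (m + 1)) (insert (m + 1) U) (m + 1) = 1 := by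
  unfold letterWeight
  rw [cut_insPred_self (Or.inr rfl) hum hu, if_neg hu0, if_neg]
  simp [Closed]

open scoped Classical in
theorem letterWeight_insPred_closed (hr : IsPred m r) (hU : U ⊆ Icc 1 m) (hum : u ≤ m)
    (hu0 : u ≠ 0) (hu : u ∉ U) :
    letterWeight x y c (insPred r u (m + 1)) U (m + 1) =
      if c (cut (insPred r u (m + 1)) U) (m + 1) then y (m + 1) else 1 := by
  unfold letterWeight
  rw [cut_insPred_self (Or.inl rfl) hum hu, if_neg hu0]
  have : Closed (insPred r u (m + 1)) U (m + 1) := by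
    refine ⟨succ_notMem_of_subset hU, fun b => ?_⟩
    unfold insPred
    have := hr.apply_le b
    split_ifs <;> omega
  simp [this]

end Insertion

/-- Reindexing by the set `U` of letters open before the insertion: a run started at the front or
behind `u ∈ U` keeps `U`, and filling `u` leaves `U.erase u`. -/
theorem sum_range_sum_powerset {R : Type*} [AddCommMonoid R] (m : ℕ)
    (g : ℕ → Finset ℕ → R) :
    ∑ u ∈ range (m + 1), ∑ S ∈ (Icc 1 (m + 1)).powerset, g u S =
      ∑ U ∈ (Icc 1 m).powerset,
        ((g 0 U + g 0 (insert (m + 1) U)) +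
          ∑ u ∈ U, ((g u U + g u (insert (m + 1) U)) +
            (g u (U.erase u) + g u (insert (m + 1) (U.erase u))))) := by
  have h1 : ∀ u, ∑ S ∈ (Icc 1 (m + 1)).powerset, g u S =
      ∑ U ∈ (Icc 1 m).powerset, (g u U + g u (insert (m + 1) U)) := by
    intro u
    have : Icc 1 (m + 1) = insert (m + 1) (Icc 1 m) := by
      ext a
      simp only [mem_Icc, mem_insert]
      omega
    rw [this, sum_powerset_insert (by simp), sum_add_distrib]
  have h2 : range (m + 1) = insert 0 (Icc 1 m) := by
    ext a
    simp only [mem_range, mem_Icc, mem_insert]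
    omega
  simp only [h1]
  rw [h2, sum_insert (by simp)]
  refine Eq.trans ?_ sum_add_distrib.symm
  congr 1
  have h3 : ∀ u ∈ Icc 1 m, ∀ f : Finset ℕ → R, ∑ U ∈ (Icc 1 m).powerset, f U =
      ∑ U ∈ (Icc 1 m).powerset with u ∈ U, (f U + f (U.erase u)) := by
    intro u hu f
    rw [sum_add_distrib, ← sum_filter_add_sum_filter_not (Icc 1 m).powerset (fun U => u ∈ U)]
    congr 1
    refine sum_nbij' (fun U => insert u U) (fun U => U.erase u) ?_ ?_ ?_ ?_ ?_
    · intro U hU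
      simp only [mem_filter, mem_powerset] at hU ⊢
      exact ⟨insert_subset hu hU.1, mem_insert_self _ _⟩
    · intro U hU
      simp only [mem_filter, mem_powerset] at hU ⊢
      exact ⟨(erase_subset _ _).trans hU.1, notMem_erase _ _⟩
    · intro U hU
      exact erase_insert (mem_filter.1 hU).2
    · intro U hU
      exact insert_erase (mem_filter.1 hU).2
    · intro U hU
      rw [erase_insert (mem_filter.1 hU).2]
  refine (sum_congr rfl fun u hu => h3 u hu _).trans (sum_comm' ?_)
  intro u U
  simp only [mem_filter, mem_powerset]
  constructor
  · rintro ⟨-, h, h'⟩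
    exact ⟨h', h⟩
  · rintro ⟨h', h⟩
    exact ⟨h h', h, h'⟩


/-! ### One step of the two recursions -/

section Step

variable {R : Type*} [CommSemiring R] (x y : ℕ → R) {c : (ℕ → ℕ) → ℕ → Prop}
  {m : ℕ} {r : ℕ → ℕ}

open scoped Classical in
theorem sum_weight_insPred (hc : IsLocal c) (hr : IsPred m r) (F : ℕ → Finset ℕ → R) :
    ∑ u ∈ range (m + 1), ∑ S ∈ (Icc 1 (m + 1)).powerset,
        weight x y c (m + 1) (insPred r u (m + 1)) S * F u S =
      ∑ U ∈ (Icc 1 m).powerset, weight x y c m r U *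
        (x (m + 1) * (F 0 U + F 0 (insert (m + 1) U)) +
          ∑ u ∈ U, (x (m + 1) * (F u U + F u (insert (m + 1) U)) +
            ((if c (cut (insPred r u (m + 1)) (U.erase u)) (m + 1) then y (m + 1) else 1) *
                F u (U.erase u) +
              F u (insert (m + 1) (U.erase u))))) := by
  rw [sum_range_sum_powerset]
  refine sum_congr rfl fun U hU => ?_
  rw [mem_powerset] at hU
  have hs : ∀ u ≤ m, u = 0 ∨ u ∈ U → ∀ S, S = U ∨ S = insert (m + 1) U →
      weight x y c (m + 1) (insPred r u (m + 1)) S = weight x y c m r U * x (m + 1) := by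
    intro u hum hu S hS
    rw [weight_insPred x y hc hr hS hU (Or.inl ⟨rfl, hu⟩),
      letterWeight_insPred_start x y hS hu]
  rw [hs 0 (Nat.zero_le _) (Or.inl rfl) U (Or.inl rfl),
    hs 0 (Nat.zero_le _) (Or.inl rfl) _ (Or.inr rfl), mul_add, mul_sum]
  congr 1
  · ring
  refine sum_congr rfl fun u hu => ?_
  have hu' := mem_Icc.1 (hU hu)
  have hE : U.erase u ⊆ Icc 1 m := (erase_subset _ _).trans hU
  have hT : U = insert u (U.erase u) ∧ u ≠ 0 := ⟨(insert_erase hu).symm, by omega⟩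
  rw [hs u hu'.2 (Or.inr hu) U (Or.inl rfl), hs u hu'.2 (Or.inr hu) _ (Or.inr rfl),
    weight_insPred x y hc hr (Or.inl rfl) hE (Or.inr hT),
    weight_insPred x y hc hr (Or.inr rfl) hE (Or.inr hT),
    letterWeight_insPred_open x y hu'.2 hT.2 (notMem_erase _ _),
    letterWeight_insPred_closed x y hr hE hu'.2 hT.2 (notMem_erase _ _)]
  ring

/-- Summand in which the kernel `V` is applied to the number of open letters other than the
marked letter `t`, which has to be open. -/
def openKernel (V : ℕ → R) (t : ℕ) (S : Finset ℕ) : R :=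
  if t ∈ S then V (S.erase t).card else 0

/-- Summand in which the kernel depends on whether the marked letter `t` is open. -/
def markKernel (A B : ℕ → R) (t : ℕ) (S : Finset ℕ) : R :=
  if t ∈ S then A (S.erase t).card else B S.card

/-- One step of the recursion for peak-values. -/
def stepV (a b : R) (V : ℕ → R) (g : ℕ) : R :=
  a * ((g + 2) * V (g + 1) + (g + 1) * V g) + (g + 1) * V g + b * (g * V (g - 1))

/-- One step of the recursion for sorted peak-values, when the latest run is open. -/
def stepA (a b : R) (A B : ℕ → R) (g : ℕ) : R :=
  a * ((g + 2) * A (g + 1) + (g + 2) * B (g + 1)) + (g + 1) * A g + B g + b * (g * A (g - 1))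

/-- One step of the recursion for sorted peak-values, when the latest run is closed. -/
def stepB (a b : R) (A B : ℕ → R) (g : ℕ) : R :=
  a * ((g + 1) * A g + (g + 1) * B g) + g * B g + b * (g * B (g - 1))

/-- A letter put behind `l` takes over the mark and must itself be open. So with `g` other open
letters, an open new run has `g + 2` places, a closed one only `g + 1`, and the run of `l` cannot be
closed. -/
theorem step_openKernel (hr : IsPred m r) {l : ℕ} (hl : l ∈ Icc 1 m) (V : ℕ → R) :
    ∑ u ∈ range (m + 1), ∑ S ∈ (Icc 1 (m + 1)).powerset,
        weight x y (fun _ _ => True) (m + 1) (insPred r u (m + 1)) S *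
          openKernel V (if u = l then m + 1 else l) S =
      ∑ U ∈ (Icc 1 m).powerset, weight x y (fun _ _ => True) m r U *
        openKernel (stepV (x (m + 1)) (y (m + 1)) V) l U := by
  rw [sum_weight_insPred x y (fun _ _ _ _ => Iff.rfl) hr]
  refine sum_congr rfl fun U hU => ?_
  rw [mem_powerset] at hU
  congr 1
  rw [mem_Icc] at hl
  have hv := succ_notMem_of_subset hU
  have h0 := zero_notMem_of_subset hU
  have hl0 : (0 : ℕ) ≠ l := by omega
  have hlv : l ≠ m + 1 := by omega
  simp only [if_true, if_neg hl0]
  by_cases hlU : l ∈ U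
  · have hcard : ∀ u ∈ U.erase l, ((U.erase u).erase l).card = (U.erase l).card - 1 := by
      intro u hu
      rw [erase_right_comm, card_erase_of_mem hu]
    have hcard' : ∀ T : Finset ℕ, T ⊆ U → ((insert (m + 1) T).erase l).card =
        (T.erase l).card + 1 := by
      intro T hT
      rw [erase_insert_of_ne hlv.symm, card_insert_of_notMem]
      exact fun h => hv (hT (mem_of_mem_erase h))
    -- The truncated `g - 1` is evaluated only for some `u ∈ U.erase l`, hence with `g ≥ 1`; in
    -- `stepV` it carries the factor `g`.
    have hpos : ∀ u ∈ U.erase l, (U.erase l).card - 1 + 1 = (U.erase l).card := by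
      intro u hu
      have := card_pos.2 ⟨u, hu⟩
      omega
    rw [← add_sum_erase U _ hlU]
    have hsum : ∀ u ∈ U.erase l, (x (m + 1) * (openKernel V (if u = l then m + 1 else l) U +
          openKernel V (if u = l then m + 1 else l) (insert (m + 1) U)) +
        (y (m + 1) * openKernel V (if u = l then m + 1 else l) (U.erase u) +
          openKernel V (if u = l then m + 1 else l) (insert (m + 1) (U.erase u)))) =
        x (m + 1) * (V (U.erase l).card + V ((U.erase l).card + 1)) +
          (y (m + 1) * V ((U.erase l).card - 1) + V (U.erase l).card) := by
      intro u hu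
      have hul := (mem_erase.1 hu).1
      have hlu : l ∈ U.erase u := mem_erase.2 ⟨hul.symm, hlU⟩
      simp only [if_neg hul, openKernel, if_pos hlU, if_pos hlu, mem_insert_of_mem hlU,
        mem_insert_of_mem hlu, if_true]
      rw [hcard' U (Subset.refl _), hcard' _ (erase_subset _ _), hcard u hu, hpos u hu]
    rw [sum_congr rfl hsum, sum_const, nsmul_eq_mul]
    have hve : m + 1 ∉ U.erase l := fun h => hv (mem_of_mem_erase h)
    simp only [if_true, openKernel, if_pos hlU, mem_insert_of_mem hlU, if_neg hv, if_neg hve,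
      mem_insert_self, hcard' U (Subset.refl _), erase_insert hv, erase_insert hve, stepV]
    rw [← card_erase_add_one hlU]
    ring
  · have hins : ∀ T ⊆ U, l ∉ insert (m + 1) T := by
      intro T hT h
      rcases mem_insert.1 h with h | h
      · exact hlv h
      · exact hlU (hT h)
    simp only [openKernel, if_neg hlU, if_neg (hins U (Subset.refl _))]
    rw [sum_eq_zero, add_zero, add_zero, mul_zero]
    intro u hu
    have hul : u ≠ l := fun h => hlU (h ▸ hu)
    have hle : l ∉ U.erase u := fun h => hlU (mem_of_mem_erase h)
    simp only [if_neg hul, if_neg hlU, if_neg (hins U (Subset.refl _)), if_neg hle,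
      if_neg (hins _ (erase_subset u U)), add_zero, mul_zero]

/-- The largest letter up to `v` of the run with the largest start up to `v`. -/
def tip (f : ℕ → ℕ) : ℕ → ℕ
  | 0 => 0
  | v + 1 => if f (v + 1) = 0 ∨ f (v + 1) = tip f v then v + 1 else tip f v

theorem tip_congr {f g : ℕ → ℕ} : ∀ {v : ℕ}, (∀ b ≤ v, f b = g b) → tip f v = tip g v
  | 0, _ => rfl
  | v + 1, h => by
    have ih : tip f v = tip g v := tip_congr fun b hb => h b (by omega)
    simp only [tip, h (v + 1) le_rfl, ih]

theorem tip_le (f : ℕ → ℕ) : ∀ v, tip f v ≤ v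
  | 0 => le_rfl
  | v + 1 => by
    have := tip_le f v
    simp only [tip]
    split_ifs <;> omega

/-- The predecessor of `v` does not belong to the run with the latest start before `v`. -/
def NotLatest (f : ℕ → ℕ) (v : ℕ) : Prop :=
  f v ≠ tip f (v - 1)

theorem isLocal_notLatest : IsLocal NotLatest := fun f g v h => by
  unfold NotLatest
  rw [h v le_rfl, tip_congr fun b hb => h b (by omega)]

/-- A new run always takes the mark, and `m + 1` being open or not selects `A` or `B`. Filling the
marked letter moves the mark to `m + 1`, and closing that run costs `1` instead of `y`: this is the
bare `B g` in `stepA`. -/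
theorem step_markKernel (hr : IsPred m r) (A B : ℕ → R) :
    ∑ u ∈ range (m + 1), ∑ S ∈ (Icc 1 (m + 1)).powerset,
        weight x y NotLatest (m + 1) (insPred r u (m + 1)) S *
          markKernel A B (tip (cut (insPred r u (m + 1)) S) (m + 1)) S =
      ∑ U ∈ (Icc 1 m).powerset, weight x y NotLatest m r U *
        markKernel (stepA (x (m + 1)) (y (m + 1)) A B) (stepB (x (m + 1)) (y (m + 1)) A B)
          (tip (cut r U) m) U := by
  classical
  rw [sum_weight_insPred x y isLocal_notLatest hr
    (fun u S => markKernel A B (tip (cut (insPred r u (m + 1)) S) (m + 1)) S)]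
  refine sum_congr rfl fun U hU => ?_
  rw [mem_powerset] at hU
  congr 1
  set t := tip (cut r U) m with ht
  have htm : t ≤ m := tip_le _ _
  have hv := succ_notMem_of_subset hU
  have h0 := zero_notMem_of_subset hU
  have hstart : ∀ u ≤ m, u = 0 ∨ u ∈ U → ∀ S, S = U ∨ S = insert (m + 1) U →
      tip (cut (insPred r u (m + 1)) S) (m + 1) = m + 1 := by
    intro u hum hu S hS
    simp only [tip]
    rw [if_pos]
    left
    simp only [cut, insPred, if_true]
    rcases hu with rfl | hu
    · simp
    · rw [if_pos]
      rcases hS with rfl | rfl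
      · exact hu
      · exact mem_insert_of_mem hu
  have hprev : ∀ u ∈ U, ∀ S, S = U.erase u ∨ S = insert (m + 1) (U.erase u) →
      tip (cut (insPred r u (m + 1)) S) m = t := by
    intro u hu S hS
    refine tip_congr fun b hb => ?_
    have hu' := mem_Icc.1 (hU hu)
    exact cut_insPred hr hS ((erase_subset _ _).trans hU)
      (Or.inr ⟨(insert_erase hu).symm, by omega⟩) (by omega)
  have hcut : ∀ u ∈ U, ∀ S, S = U.erase u ∨ S = insert (m + 1) (U.erase u) →
      cut (insPred r u (m + 1)) S (m + 1) = u := by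
    intro u hu S hS
    exact cut_insPred_self hS (mem_Icc.1 (hU hu)).2 (notMem_erase _ _)
  have hnext : ∀ u ∈ U, ∀ S, S = U.erase u ∨ S = insert (m + 1) (U.erase u) →
      tip (cut (insPred r u (m + 1)) S) (m + 1) = if u = t then m + 1 else t := by
    intro u hu S hS
    have hu' := mem_Icc.1 (hU hu)
    simp only [tip, hprev u hu S hS, hcut u hu S hS]
    have : u ≠ 0 := by omega
    simp [this]
  have hlast : ∀ u ∈ U, (NotLatest (cut (insPred r u (m + 1)) (U.erase u)) (m + 1) ↔ u ≠ t) := by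
    intro u hu
    unfold NotLatest
    rw [hcut u hu _ (Or.inl rfl), Nat.add_sub_cancel, hprev u hu _ (Or.inl rfl)]
  have hsum : ∀ u ∈ U,
      (x (m + 1) * (markKernel A B (tip (cut (insPred r u (m + 1)) U) (m + 1)) U +
          markKernel A B (tip (cut (insPred r u (m + 1)) (insert (m + 1) U)) (m + 1))
            (insert (m + 1) U)) +
        ((if NotLatest (cut (insPred r u (m + 1)) (U.erase u)) (m + 1) then y (m + 1) else 1) *
            markKernel A B (tip (cut (insPred r u (m + 1)) (U.erase u)) (m + 1)) (U.erase u) +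
          markKernel A B (tip (cut (insPred r u (m + 1)) (insert (m + 1) (U.erase u))) (m + 1))
            (insert (m + 1) (U.erase u)))) =
      x (m + 1) * (B U.card + A U.card) +
        ((if u = t then 1 else y (m + 1)) *
            markKernel A B (if u = t then m + 1 else t) (U.erase u) +
          markKernel A B (if u = t then m + 1 else t) (insert (m + 1) (U.erase u))) := by
    intro u hu
    have hu' := mem_Icc.1 (hU hu)
    rw [hstart u hu'.2 (Or.inr hu) _ (Or.inl rfl), hstart u hu'.2 (Or.inr hu) _ (Or.inr rfl),
      hnext u hu _ (Or.inl rfl), hnext u hu _ (Or.inr rfl)]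
    simp only [hlast u hu, ne_eq, ite_not]
    simp only [markKernel, if_neg hv, mem_insert_self, if_true, erase_insert hv]
  rw [sum_congr rfl hsum, hstart 0 (Nat.zero_le _) (Or.inl rfl) _ (Or.inl rfl),
    hstart 0 (Nat.zero_le _) (Or.inl rfl) _ (Or.inr rfl)]
  have htv : t ≠ m + 1 := by omega
  by_cases htU : t ∈ U
  · have hrest : ∀ u ∈ U.erase t, (x (m + 1) * (B U.card + A U.card) +
        ((if u = t then 1 else y (m + 1)) *
            markKernel A B (if u = t then m + 1 else t) (U.erase u) +
          markKernel A B (if u = t then m + 1 else t) (insert (m + 1) (U.erase u)))) =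
        x (m + 1) * (B U.card + A U.card) +
          (y (m + 1) * A ((U.erase t).card - 1) + A (U.erase t).card) := by
      intro u hu
      have hut := (mem_erase.1 hu).1
      have htu : t ∈ U.erase u := mem_erase.2 ⟨hut.symm, htU⟩
      have hpos := card_pos.2 ⟨u, hu⟩
      simp only [if_neg hut, markKernel, if_pos htu, mem_insert_of_mem htu, if_true]
      rw [erase_insert_of_ne htv.symm, card_insert_of_notMem, erase_right_comm,
        card_erase_of_mem hu, Nat.sub_add_cancel hpos]
      exact fun h => hv (mem_of_mem_erase (mem_of_mem_erase h))
    rw [← add_sum_erase U _ htU, sum_congr rfl hrest, sum_const, nsmul_eq_mul]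
    have hve : m + 1 ∉ U.erase t := fun h => hv (mem_of_mem_erase h)
    simp only [if_true, markKernel, if_neg hv, if_pos htU, if_neg hve, mem_insert_self,
      erase_insert hv, erase_insert hve, stepA]
    rw [← card_erase_add_one htU]
    ring
  · have hrest : ∀ u ∈ U, (x (m + 1) * (B U.card + A U.card) +
        ((if u = t then 1 else y (m + 1)) *
            markKernel A B (if u = t then m + 1 else t) (U.erase u) +
          markKernel A B (if u = t then m + 1 else t) (insert (m + 1) (U.erase u)))) =
        x (m + 1) * (B U.card + A U.card) +
          (y (m + 1) * B (U.card - 1) + B U.card) := by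
      intro u hu
      have hut : u ≠ t := fun h => htU (h ▸ hu)
      have htu : t ∉ U.erase u := fun h => htU (mem_of_mem_erase h)
      have hti : t ∉ insert (m + 1) (U.erase u) := by
        rw [mem_insert]
        rintro (h | h)
        · exact htv h
        · exact htu h
      have hpos := card_pos.2 ⟨u, hu⟩
      simp only [if_neg hut, markKernel, if_neg htu, if_neg hti]
      rw [card_insert_of_notMem fun h => hv (mem_of_mem_erase h), card_erase_of_mem hu,
        Nat.sub_add_cancel hpos]
    rw [sum_congr rfl hrest, sum_const, nsmul_eq_mul]
    simp only [markKernel, if_neg hv, if_neg htU, mem_insert_self, if_true, erase_insert hv, stepB]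
    ring

end Step

/-! ### Comparison of the kernels -/

section Kernels

variable {R : Type*} [CommSemiring R] (x y : ℕ → R)

/-- The kernel for peak-values, when `k` letters larger than `m` have still to be inserted. -/
def kerV : ℕ → ℕ → ℕ → R
  | 0, _ => fun g => if g = 0 then 1 else 0
  | k + 1, m => stepV (x (m + 1)) (y (m + 1)) (kerV k (m + 1))

/-- The pair of kernels for sorted peak-values, when `k` letters larger than `m` have still to be
inserted. -/
def kerAB : ℕ → ℕ → (ℕ → R) × (ℕ → R)
  | 0, _ => (fun _ => 0, fun g => if g = 0 then 1 else 0)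
  | k + 1, m =>
    (stepA (x (m + 1)) (y (m + 1)) (kerAB k (m + 1)).1 (kerAB k (m + 1)).2,
      stepB (x (m + 1)) (y (m + 1)) (kerAB k (m + 1)).1 (kerAB k (m + 1)).2)

/-- The terms `(g + 1) * A g + B g` of `stepA` and `g * B g` of `stepB` add up to `g + 1` times `A g
+ B g`; all other terms pair off directly. -/
theorem kerV_eq (k : ℕ) : ∀ m g, kerV x y k m g = (kerAB x y k m).1 g + (kerAB x y k m).2 g := by
  induction k with
  | zero =>
    intro m g
    simp [kerV, kerAB]
  | succ k ih =>
    intro m g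
    simp only [kerV, kerAB, stepV, stepA, stepB, ih]
    ring

end Kernels


/-! ### Adjacent letters and ascent predecessors -/

section Adjacency

variable {α : Type*}

/-- The letter `b` directly follows the letter `a` in the word `w`. -/
def Adj (w : List α) (a b : α) : Prop :=
  [a, b] <:+: w

theorem not_adj_nil (a b : α) : ¬ Adj [] a b := by
  simp [Adj]

theorem adj_cons {c : α} {l : List α} {a b : α} :
    Adj (c :: l) a b ↔ (c = a ∧ l.head? = some b) ∨ Adj l a b := by
  unfold Adj
  rw [List.infix_cons_iff, List.cons_prefix_cons]
  refine or_congr (and_congr eq_comm ?_) Iff.rfl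
  cases l with
  | nil => simp
  | cons d l => simp [List.cons_prefix_cons, eq_comm]

theorem adj_append {s t : List α} {a b : α} :
    Adj (s ++ t) a b ↔
      Adj s a b ∨ Adj t a b ∨ (s.getLast? = some a ∧ t.head? = some b) := by
  induction s with
  | nil => simp [not_adj_nil]
  | cons c s ih =>
    rw [List.cons_append, adj_cons, ih, adj_cons]
    cases s with
    | nil => simp [not_adj_nil]; tauto
    | cons d s => simp [List.getLast?_cons_cons]; tauto

theorem Adj.mem_left {w : List α} {a b : α} (h : Adj w a b) : a ∈ w :=
  h.subset (by simp)

theorem Adj.mem_right {w : List α} {a b : α} (h : Adj w a b) : b ∈ w :=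
  h.subset (by simp)

theorem Adj.mem_tail {w : List α} {a b : α} (h : Adj w a b) : b ∈ w.tail := by
  cases w with
  | nil => exact absurd h (not_adj_nil _ _)
  | cons c l =>
    rcases adj_cons.1 h with ⟨-, h⟩ | h
    · exact List.mem_of_head? h
    · exact h.mem_right

theorem Adj.right_unique {w : List α} (hw : w.Nodup) {a b b' : α} (h : Adj w a b)
    (h' : Adj w a b') : b = b' := by
  induction w with
  | nil => exact absurd h (not_adj_nil _ _)
  | cons c l ih =>
    rw [List.nodup_cons] at hw
    rcases adj_cons.1 h with ⟨rfl, h1⟩ | h1 <;> rcases adj_cons.1 h' with ⟨h3, h2⟩ | h2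
    · rw [h1] at h2
      exact Option.some.inj h2
    · exact absurd h2.mem_left hw.1
    · exact absurd (h3 ▸ h1.mem_left) hw.1
    · exact ih hw.2 h1 h2

theorem Adj.left_unique {w : List α} (hw : w.Nodup) {a a' b : α} (h : Adj w a b)
    (h' : Adj w a' b) : a = a' := by
  induction w with
  | nil => exact absurd h (not_adj_nil _ _)
  | cons c l ih =>
    rw [List.nodup_cons] at hw
    have key : ∀ d, l.head? = some b → Adj l d b → False := by
      intro d h1 h2
      cases l with
      | nil => simp at h1
      | cons e l =>
        simp only [List.head?_cons, Option.some.injEq] at h1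
        subst h1
        exact (List.nodup_cons.1 hw.2).1 h2.mem_tail
    rcases adj_cons.1 h with ⟨h3, h1⟩ | h1 <;> rcases adj_cons.1 h' with ⟨h4, h2⟩ | h2
    · exact h3.symm.trans h4
    · exact (key _ h1 h2).elim
    · exact (key _ h2 h1).elim
    · exact ih hw.2 h1 h2

open scoped Classical in
/-- The letter directly before `b` in `w` if it is smaller than `b`, and `0` otherwise. -/
noncomputable def ascPred (w : List ℕ) (b : ℕ) : ℕ :=
  if h : ∃ a, a < b ∧ Adj w a b then h.choose else 0

theorem ascPred_eq_iff {w : List ℕ} (hw : w.Nodup) {a b : ℕ} (ha : a ≠ 0) :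
    ascPred w b = a ↔ a < b ∧ Adj w a b := by
  unfold ascPred
  split_ifs with h
  · have hs := h.choose_spec
    constructor
    · intro h'
      rw [h'] at hs
      exact hs
    · intro h'
      exact hs.2.left_unique hw h'.2
  · constructor
    · intro h'
      exact absurd h'.symm ha
    · intro h'
      exact absurd ⟨a, h'⟩ h

theorem ascPred_spec {w : List ℕ} {b : ℕ} (h : ascPred w b ≠ 0) :
    ascPred w b < b ∧ Adj w (ascPred w b) b := by
  unfold ascPred at h ⊢
  split_ifs with h'
  · exact h'.choose_spec
  · rw [dif_neg h'] at h
    exact absurd rfl h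

end Adjacency

/-! ### Permutation words and insertion -/

section Words

theorem oneLine_injective {n : ℕ} :
    Function.Injective (oneLine : Equiv.Perm (Fin n) → List ℕ) := by
  intro π σ h
  have := List.ofFn_injective h
  ext i
  have := congrFun this i
  simpa using this

/-- The words of the permutations of `{1, …, n}`. -/
def words (n : ℕ) : Finset (List ℕ) :=
  univ.image (oneLine : Equiv.Perm (Fin n) → List ℕ)

theorem nodup_oneLine {n : ℕ} (π : Equiv.Perm (Fin n)) : (oneLine π).Nodup := by
  unfold oneLine
  rw [List.nodup_ofFn]
  intro i j h
  exact π.injective (Fin.ext (by simpa using h))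

theorem mem_words {n : ℕ} {w : List ℕ} :
    w ∈ words n ↔ w.Nodup ∧ ∀ a, a ∈ w ↔ 1 ≤ a ∧ a ≤ n := by
  constructor
  · intro h
    obtain ⟨π, -, rfl⟩ := mem_image.1 h
    refine ⟨nodup_oneLine π, fun a => ?_⟩
    unfold oneLine
    rw [List.mem_ofFn]
    constructor
    · rintro ⟨i, rfl⟩
      have := (π i).2
      omega
    · rintro ⟨h1, h2⟩
      refine ⟨π.symm ⟨a - 1, by omega⟩, ?_⟩
      simp
      omega
  · rintro ⟨hw, h⟩
    have hlen : w.length = n := by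
      have h1 : w.toFinset = Icc 1 n := by
        ext a
        rw [List.mem_toFinset, h, mem_Icc]
      rw [← List.toFinset_card_of_nodup hw, h1]
      simp
    have hget : ∀ i : Fin n, 1 ≤ w[(i : ℕ)]'(by omega) ∧ w[(i : ℕ)]'(by omega) ≤ n :=
      fun i => (h _).1 (List.getElem_mem _)
    let f : Fin n → Fin n := fun i => ⟨w[(i : ℕ)]'(by omega) - 1, by have := hget i; omega⟩
    have hf : Function.Injective f := by
      intro i j hij
      have h1 := congrArg Fin.val hij
      have h2 := hget i
      have h3 := hget j
      simp only [f] at h1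
      have h4 : w[(i : ℕ)]'(by omega) = w[(j : ℕ)]'(by omega) := by omega
      exact Fin.ext ((hw.getElem_inj_iff).1 h4)
    refine mem_image.2 ⟨Equiv.ofBijective f (Finite.injective_iff_bijective.1 hf), mem_univ _, ?_⟩
    unfold oneLine
    refine List.ext_getElem (by simp [hlen]) fun i h1 h2 => ?_
    have := hget ⟨i, by omega⟩
    simp only [List.getElem_ofFn, Equiv.ofBijective_apply, f]
    simp only at this
    omega

theorem sum_oneLine {M : Type*} [AddCommMonoid M] (n : ℕ) (F : List ℕ → M) :
    ∑ π : Equiv.Perm (Fin n), F (oneLine π) = ∑ w ∈ words n, F w := by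
  rw [words, sum_image oneLine_injective.injOn]

/-- Insert `v` directly behind the letter `u`. -/
def insertAfter (u v : ℕ) : List ℕ → List ℕ
  | [] => []
  | a :: l => if a = u then a :: v :: l else a :: insertAfter u v l

/-- Insert `v` directly behind the letter `u`, or at the front if `u = 0`. -/
def ins (u v : ℕ) (w : List ℕ) : List ℕ :=
  if u = 0 then v :: w else insertAfter u v w

theorem insertAfter_append {u v : ℕ} {s t : List ℕ} (h : u ∉ s) :
    insertAfter u v (s ++ u :: t) = s ++ u :: v :: t := by
  induction s with
  | nil => simp [insertAfter]
  | cons a s ih =>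
    simp only [List.mem_cons, not_or] at h
    simp only [List.cons_append, insertAfter, if_neg (Ne.symm h.1), ih h.2]

theorem ins_cases {m u : ℕ} (v : ℕ) {w : List ℕ} (hw : w ∈ words m) (hu : u ≤ m) :
    (u = 0 ∧ ins u v w = v :: w) ∨
      (u ≠ 0 ∧ ∃ s t, w = s ++ u :: t ∧ ins u v w = s ++ u :: v :: t) := by
  rw [mem_words] at hw
  by_cases h0 : u = 0
  · exact Or.inl ⟨h0, by simp [ins, h0]⟩
  · have : u ∈ w := (hw.2 u).2 ⟨by omega, hu⟩
    obtain ⟨s, t, rfl⟩ := List.append_of_mem this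
    refine Or.inr ⟨h0, s, t, rfl, ?_⟩
    rw [ins, if_neg h0, insertAfter_append]
    intro h
    exact (List.disjoint_of_nodup_append hw.1) h (by simp)

theorem perm_ins {m u : ℕ} (v : ℕ) {w : List ℕ} (hw : w ∈ words m) (hu : u ≤ m) :
    (ins u v w).Perm (v :: w) := by
  rcases ins_cases v hw hu with ⟨-, h⟩ | ⟨-, s, t, rfl, h⟩
  · rw [h]
  · rw [h]
    have := List.perm_middle (a := v) (l₁ := s ++ [u]) (l₂ := t)
    simpa using this

theorem ins_mem_words {m u : ℕ} {w : List ℕ} (hw : w ∈ words m) (hu : u ≤ m) :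
    ins u (m + 1) w ∈ words (m + 1) := by
  have hp := perm_ins (m + 1) hw hu
  rw [mem_words] at hw ⊢
  rw [hp.nodup_iff, List.nodup_cons]
  refine ⟨⟨fun h => ?_, hw.1⟩, fun a => ?_⟩
  · have := (hw.2 _).1 h
    omega
  · rw [hp.mem_iff, List.mem_cons, hw.2]
    omega

theorem isPred_ascPred {m : ℕ} {w : List ℕ} (hw : w ∈ words m) : IsPred m (ascPred w) := by
  rw [mem_words] at hw
  refine ⟨fun b hb => (ascPred_spec hb).1, fun b hb => ?_⟩
  exact ((hw.2 b).1 (ascPred_spec hb).2.mem_right).2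

/-- The letter that used to follow `u` now follows the larger `m + 1`, so its ascent predecessor
drops to `0`. -/
theorem ascPred_ins {m u : ℕ} {w : List ℕ} (hw : w ∈ words m) (hu : u ≤ m) :
    ascPred (ins u (m + 1) w) = insPred (ascPred w) u (m + 1) := by
  have hw' := mem_words.1 hw
  have hi := ins_mem_words hw hu
  have hi' := mem_words.1 hi
  have hlt : m + 1 ∉ w := fun h => by
    have := (hw'.2 _).1 h
    omega
  -- It suffices to compare nonzero values, since `0` is the default value that `ascPred_eq_iff`
  -- excludes.
  have ext0 : ∀ p q : ℕ, (∀ a, a ≠ 0 → (p = a ↔ q = a)) → p = q := by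
    intro p q h
    by_cases hp : p = 0
    · by_cases hq : q = 0
      · rw [hp, hq]
      · exact (h q hq).2 rfl
    · exact ((h p hp).1 rfl).symm
  funext b
  apply ext0
  intro a ha
  rw [ascPred_eq_iff hi'.1 ha]
  unfold insPred
  by_cases hb : b = m + 1
  · rw [if_pos hb, hb]
    rcases ins_cases (m + 1) hw hu with ⟨h0, h⟩ | ⟨h0, s, t, h1, h⟩
    · constructor
      · rintro ⟨-, h'⟩
        rw [h] at h'
        exact absurd h'.mem_tail hlt
      · intro h'
        exact absurd (h'.symm.trans h0) ha
    · have hadj : Adj (ins u (m + 1) w) u (m + 1) := by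
        rw [h]
        exact ⟨s, t, by simp⟩
      constructor
      · rintro ⟨-, h'⟩
        exact hadj.left_unique hi'.1 h'
      · rintro rfl
        exact ⟨by omega, hadj⟩
  · rw [if_neg hb]
    have hR : (if ascPred w b = u then 0 else ascPred w b) = a ↔ a ≠ u ∧ a < b ∧ Adj w a b := by
      rw [← ascPred_eq_iff hw'.1 ha]
      split_ifs with h
      · constructor
        · intro h'
          exact absurd h'.symm ha
        · rintro ⟨h1, h2⟩
          exact absurd (h2.symm.trans h) h1
      · constructor
        · rintro rfl
          exact ⟨h, rfl⟩
        · exact And.right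
    rw [hR]
    rcases ins_cases (m + 1) hw hu with ⟨h0, h⟩ | ⟨h0, s, t, h1, h⟩
    · rw [h, adj_cons]
      constructor
      · rintro ⟨hab, ⟨rfl, h2⟩ | h2⟩
        · have := (hw'.2 _).1 (List.mem_of_head? h2)
          omega
        · exact ⟨by omega, hab, h2⟩
      · rintro ⟨-, hab, h2⟩
        exact ⟨hab, Or.inr h2⟩
    · have hadj : Adj (ins u (m + 1) w) u (m + 1) := by
        rw [h]
        exact ⟨s, t, by simp⟩
      constructor
      · rintro ⟨hab, h2⟩
        have hau : a ≠ u := by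
          rintro rfl
          exact hb (h2.right_unique hi'.1 hadj)
        refine ⟨hau, hab, ?_⟩
        have hbm := ((hi'.2 _).1 h2.mem_right).2
        rw [h, adj_append, adj_cons, adj_cons] at h2
        rw [h1, adj_append, adj_cons]
        rcases h2 with h2 | (⟨h2, -⟩ | ⟨h2, -⟩ | h2) | h2
        · exact Or.inl h2
        · exact absurd h2.symm hau
        · omega
        · exact Or.inr (Or.inl (Or.inr h2))
        · exact Or.inr (Or.inr (by simpa using h2))
      · rintro ⟨hau, hab, h2⟩
        refine ⟨hab, ?_⟩
        rw [h1, adj_append, adj_cons] at h2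
        rw [h, adj_append, adj_cons, adj_cons]
        rcases h2 with h2 | (⟨h2, -⟩ | h2) | h2
        · exact Or.inl h2
        · exact absurd h2.symm hau
        · exact Or.inr (Or.inl (Or.inr (Or.inr h2)))
        · exact Or.inr (Or.inr (by simpa using h2))

/-- The insertion is reversible: `u` is the ascent predecessor of `m + 1`, and erasing `m + 1`
restores the old word. -/
theorem sum_words_succ {M : Type*} [AddCommMonoid M] (m : ℕ) (F : List ℕ → M) :
    ∑ w ∈ words (m + 1), F w =
      ∑ w ∈ words m, ∑ u ∈ range (m + 1), F (ins u (m + 1) w) := by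
  rw [← sum_product']
  symm
  refine sum_bij (fun p _ => ins p.2 (m + 1) p.1) ?_ ?_ ?_ ?_
  · rintro ⟨w, u⟩ h
    rw [mem_product, mem_range] at h
    exact ins_mem_words h.1 (by omega)
  · rintro ⟨w, u⟩ h ⟨w', u'⟩ h' heq
    rw [mem_product, mem_range] at h h'
    simp only at h h' heq
    have hu : u ≤ m := by omega
    have hu' : u' ≤ m := by omega
    have huu : u = u' := by
      have h1 := congrFun (ascPred_ins h.1 hu) (m + 1)
      have h2 := congrFun (ascPred_ins h'.1 hu') (m + 1)
      rw [heq, h2] at h1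
      simpa [insPred] using h1.symm
    have hlt : ∀ z ∈ words m, m + 1 ∉ z := fun z hz h => by
      have := ((mem_words.1 hz).2 _).1 h
      omega
    have herase : ∀ z ∈ words m, (ins u (m + 1) z).erase (m + 1) = z := by
      intro z hz
      have hz' := hlt z hz
      rcases ins_cases (m + 1) hz hu with ⟨-, e⟩ | ⟨-, s, t, e1, e⟩
      · rw [e, List.erase_cons_head]
      · rw [e1] at hz'
        simp only [List.mem_append, List.mem_cons, not_or] at hz'
        have := List.erase_append_right (l₁ := s ++ [u]) (a := m + 1) ((m + 1) :: t)
          (by simp only [List.mem_append, List.mem_singleton, not_or]; exact ⟨hz'.1, hz'.2.1⟩)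
        rw [e, e1]
        simpa using this
    subst huu
    have := herase w h.1
    rw [heq, herase w' h'.1] at this
    rw [this]
  · intro w hw
    have hw' := mem_words.1 hw
    obtain ⟨s, t, rfl⟩ := List.append_of_mem ((hw'.2 (m + 1)).2 ⟨by omega, le_rfl⟩)
    have hp := List.perm_middle (a := m + 1) (l₁ := s) (l₂ := t)
    have hst : s ++ t ∈ words m := by
      rw [mem_words]
      have hn := hp.nodup_iff.1 hw'.1
      rw [List.nodup_cons] at hn
      refine ⟨hn.2, fun a => ?_⟩
      have h1 := hw'.2 a
      rw [hp.mem_iff, List.mem_cons] at h1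
      constructor
      · intro ha
        have := h1.1 (Or.inr ha)
        have : a ≠ m + 1 := fun e => hn.1 (e ▸ ha)
        omega
      · intro ha
        rcases h1.2 (by omega) with h | h
        · omega
        · exact h
    rcases List.eq_nil_or_concat s with rfl | ⟨s', u, rfl⟩
    · exact ⟨(t, 0), by simpa using hst, by simp [ins]⟩
    · simp only [List.concat_eq_append, List.append_assoc, List.singleton_append] at hst hw' ⊢
      have hst' := mem_words.1 hst
      have hu := (hst'.2 u).1 (by simp)
      refine ⟨(s' ++ u :: t, u), ?_, ?_⟩
      · rw [mem_product, mem_range]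
        exact ⟨hst, by simp only; omega⟩
      · simp only [ins]
        rw [if_neg (by omega), insertAfter_append]
        intro h
        exact (List.disjoint_of_nodup_append hst'.1) h (by simp)
  · intros
    rfl

end Words


/-- The last letter of a word. -/
def lastLetter (w : List ℕ) : ℕ :=
  w.getLast?.getD 0

theorem ne_nil_of_mem_words {m : ℕ} (hm : 1 ≤ m) {w : List ℕ} (hw : w ∈ words m) : w ≠ [] := by
  rintro rfl
  have := ((mem_words.1 hw).2 1).2 ⟨le_rfl, hm⟩
  simp at this

theorem lastLetter_eq_getLast {w : List ℕ} (h : w ≠ []) : lastLetter w = w.getLast h := by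
  simp [lastLetter, List.getLast?_eq_some_getLast h]

theorem lastLetter_mem {m : ℕ} (hm : 1 ≤ m) {w : List ℕ} (hw : w ∈ words m) :
    lastLetter w ∈ Icc 1 m := by
  have h := ne_nil_of_mem_words hm hw
  rw [lastLetter_eq_getLast h, mem_Icc]
  exact ((mem_words.1 hw).2 _).1 (List.getLast_mem h)

theorem lastLetter_ins {m u : ℕ} (hm : 1 ≤ m) (v : ℕ) {w : List ℕ} (hw : w ∈ words m)
    (hu : u ≤ m) :
    lastLetter (ins u v w) = if u = lastLetter w then v else lastLetter w := by
  have hl := mem_Icc.1 (lastLetter_mem hm hw)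
  have hne := ne_nil_of_mem_words hm hw
  rcases ins_cases v hw hu with ⟨h0, h⟩ | ⟨h0, s, t, h1, h⟩
  · rw [h, if_neg (by omega), lastLetter_eq_getLast hne, lastLetter_eq_getLast (by simp),
      List.getLast_cons hne]
  · rw [h, h1]
    have hn := (mem_words.1 hw).1
    rw [h1] at hn
    rcases List.eq_nil_or_concat t with rfl | ⟨t, b, rfl⟩
    · simp [lastLetter]
    · have e1 : lastLetter (s ++ u :: t.concat b) = b := by
        simp [lastLetter, List.getLast?_append, List.getLast?_cons]
      have e2 : lastLetter (s ++ u :: v :: t.concat b) = b := by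
        simp [lastLetter, List.getLast?_append, List.getLast?_cons]
      rw [e1, e2, if_neg]
      rintro rfl
      have := (List.nodup_append.1 hn).2.1
      simp at this

/-! ### Evaluation of both weighted sums -/

section Transfer

variable {R : Type*} [CommSemiring R] (x y : ℕ → R)

theorem words_zero : words 0 = {[]} := by
  ext w
  rw [mem_words, mem_singleton]
  constructor
  · rintro ⟨-, h⟩
    refine List.eq_nil_iff_forall_not_mem.2 fun a ha => ?_
    have := (h a).1 ha
    omega
  · rintro rfl
    simp
    omega

theorem words_one : words 1 = {[1]} := by
  ext w
  rw [mem_words, mem_singleton]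
  constructor
  · rintro ⟨h1, h2⟩
    have hp : w.Perm [1] := (List.perm_ext_iff_of_nodup h1 (by simp)).2 fun a => by
      rw [h2]
      simp
      omega
    exact List.perm_singleton.1 hp
  · rintro rfl
    simp
    omega

/-- Declaring the last letter open denies it a factor `y`. For `k = 0` the kernel singles out `U =
{lastLetter w}`. -/
theorem sum_peak_transfer (k : ℕ) : ∀ m, 1 ≤ m →
    ∑ w ∈ words (m + k), weight x y (fun _ _ => True) (m + k) (ascPred w) {lastLetter w} =
      ∑ w ∈ words m, ∑ U ∈ (Icc 1 m).powerset, weight x y (fun _ _ => True) m (ascPred w) U *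
        openKernel (kerV x y k m) (lastLetter w) U := by
  induction k with
  | zero =>
    intro m hm
    refine sum_congr rfl fun w hw => ?_
    have hl := lastLetter_mem hm hw
    rw [sum_eq_single {lastLetter w}]
    · simp [openKernel, kerV]
    · intro U _ hU
      simp only [openKernel, kerV]
      split_ifs with h1 h2
      · rw [card_eq_zero] at h2
        rw [← insert_erase h1, h2] at hU
        exact absurd rfl hU
      · rw [mul_zero]
      · rw [mul_zero]
    · intro h
      exact absurd (mem_powerset.2 (singleton_subset_iff.2 hl)) h
  | succ k ih =>
    intro m hm
    have h := ih (m + 1) (by omega)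
    rw [show m + 1 + k = m + (k + 1) by ring] at h
    rw [h, sum_words_succ]
    refine sum_congr rfl fun w hw => ?_
    rw [kerV, ← step_openKernel x y (isPred_ascPred hw) (lastLetter_mem hm hw)]
    refine sum_congr rfl fun u hu => sum_congr rfl fun S _ => ?_
    have hu' : u ≤ m := by
      rw [mem_range] at hu
      omega
    rw [ascPred_ins hw hu', lastLetter_ins hm _ hw hu']

/-- The recursion starts at `m = 1`, as the empty word has no last letter to mark; there the kernel
forces `U = {1}`. -/
theorem sum_peak_weight (n : ℕ) :
    ∑ w ∈ words (n + 1),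
        weight x y (fun _ _ => True) (n + 1) (ascPred w) {lastLetter w} =
      x 1 * kerV x y n 1 0 := by
  have h := sum_peak_transfer x y n 1 le_rfl
  rw [add_comm 1 n] at h
  have hw : [1] ∈ words 1 := by
    rw [words_one]
    simp
  have hr : ascPred [1] 1 = 0 := by
    by_contra h0
    have h1 := (isPred_ascPred hw).lt 1 h0
    omega
  rw [h, words_one, sum_singleton, show Icc 1 1 = insert 1 (∅ : Finset ℕ) from rfl,
    sum_powerset_insert (by simp)]
  simp [openKernel, lastLetter, weight, letterWeight, cut, hr]

theorem sum_sorted_transfer (k : ℕ) : ∀ m,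
    ∑ w ∈ words (m + k), weight x y NotLatest (m + k) (ascPred w) ∅ =
      ∑ w ∈ words m, ∑ U ∈ (Icc 1 m).powerset, weight x y NotLatest m (ascPred w) U *
        markKernel (kerAB x y k m).1 (kerAB x y k m).2 (tip (cut (ascPred w) U) m) U := by
  induction k with
  | zero =>
    intro m
    refine sum_congr rfl fun w hw => ?_
    rw [sum_eq_single ∅]
    · simp [markKernel, kerAB]
    · intro U _ hU
      simp only [markKernel, kerAB, card_eq_zero, hU, if_false, ite_self, mul_zero]
    · intro h
      exact absurd (empty_mem_powerset _) h
  | succ k ih =>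
    intro m
    have h := ih (m + 1)
    rw [show m + 1 + k = m + (k + 1) by ring] at h
    rw [h, sum_words_succ]
    refine sum_congr rfl fun w hw => ?_
    simp only [kerAB]
    rw [← step_markKernel x y (isPred_ascPred hw)]
    refine sum_congr rfl fun u hu => sum_congr rfl fun S _ => ?_
    have hu' : u ≤ m := by
      rw [mem_range] at hu
      omega
    rw [ascPred_ins hw hu']

/-- Starting from the empty word, the first `stepB` at `g = 0` leaves `x 1` times `A 0 + B 0`, which
`kerV_eq` identifies. -/
theorem sum_sorted_weight (n : ℕ) :
    ∑ w ∈ words (n + 1), weight x y NotLatest (n + 1) (ascPred w) ∅ = x 1 * kerV x y n 1 0 := by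
  have h := sum_sorted_transfer x y (n + 1) 0
  rw [zero_add] at h
  rw [h, words_zero, sum_singleton, kerV_eq]
  simp [markKernel, weight, kerAB, stepB]

end Transfer


/-! ### Adjacency in concatenated lists -/

section Lists

variable {α : Type*}

theorem rel_of_isChain_of_adj {S : α → α → Prop} {w : List α} (h : w.IsChain S) {a b : α}
    (hab : Adj w a b) : S a b :=
  List.isChain_pair.1 (h.infix hab)

theorem Adj.getLast?_ne {w : List α} (hw : w.Nodup) {a b : α} (h : Adj w a b) :
    w.getLast? ≠ some a := by
  intro hl
  obtain ⟨s, rfl⟩ := List.getLast?_eq_some_iff.1 hl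
  rcases adj_append.1 h with h | h | ⟨h, -⟩
  · exact (List.disjoint_of_nodup_append hw) h.mem_left (by simp)
  · exact absurd h.mem_tail (by simp)
  · exact (List.disjoint_of_nodup_append hw) (List.mem_of_getLast? h) (by simp)

theorem Adj.head?_ne {w : List α} (hw : w.Nodup) {a b : α} (h : Adj w a b) :
    w.head? ≠ some b := by
  intro hl
  cases w with
  | nil => simp at hl
  | cons c w =>
    simp only [List.head?_cons, Option.some.injEq] at hl
    subst hl
    exact (List.nodup_cons.1 hw).1 h.mem_tail

theorem exists_adj_left {w : List α} {b : α} (hb : b ∈ w) (h : w.head? ≠ some b) :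
    ∃ a, Adj w a b := by
  obtain ⟨s, t, rfl⟩ := List.append_of_mem hb
  rcases List.eq_nil_or_concat s with rfl | ⟨s, a, rfl⟩
  · simp at h
  · exact ⟨a, s, t, by simp⟩

theorem exists_adj_right {w : List α} {a : α} (ha : a ∈ w) (h : w.getLast? ≠ some a) :
    ∃ b, Adj w a b := by
  obtain ⟨s, t, rfl⟩ := List.append_of_mem ha
  cases t with
  | nil => simp at h
  | cons b t => exact ⟨b, s, t, by simp⟩

theorem adj_flatten {G : List (List α)} (hG : [] ∉ G) {a b : α} :
    Adj G.flatten a b ↔ (∃ A ∈ G, Adj A a b) ∨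
      ∃ A B, Adj G A B ∧ A.getLast? = some a ∧ B.head? = some b := by
  induction G with
  | nil => simp [not_adj_nil]
  | cons A G ih =>
    simp only [List.mem_cons, not_or] at hG
    rw [List.flatten_cons, adj_append, ih hG.2]
    have hhead : G.flatten.head? = some b ↔ ∃ B, G.head? = some B ∧ B.head? = some b := by
      cases G with
      | nil => simp
      | cons B G =>
        have hB : B ≠ [] := by
          rintro rfl
          simp at hG
        obtain ⟨c, B, rfl⟩ := List.exists_cons_of_ne_nil hB
        simp
    constructor
    · rintro (h | (⟨B, hB, h⟩ | ⟨B, C, h1, h2⟩) | ⟨h1, h2⟩)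
      · exact Or.inl ⟨A, by simp, h⟩
      · exact Or.inl ⟨B, by simp [hB], h⟩
      · exact Or.inr ⟨B, C, adj_cons.2 (Or.inr h1), h2⟩
      · obtain ⟨B, hB, h3⟩ := hhead.1 h2
        exact Or.inr ⟨A, B, adj_cons.2 (Or.inl ⟨rfl, hB⟩), h1, h3⟩
    · rintro (⟨B, hB, h⟩ | ⟨B, C, h1, h2, h3⟩)
      · rcases List.mem_cons.1 hB with rfl | hB
        · exact Or.inl h
        · exact Or.inr (Or.inl (Or.inl ⟨B, hB, h⟩))
      · rcases adj_cons.1 h1 with ⟨rfl, h4⟩ | h1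
        · exact Or.inr (Or.inr ⟨h2, hhead.2 ⟨C, h4, h3⟩⟩)
        · exact Or.inr (Or.inl (Or.inr ⟨B, C, h1, h2, h3⟩))

theorem adj_iff_getElem? {w : List α} {a b : α} :
    Adj w a b ↔ ∃ i : ℕ, w[i]? = some a ∧ w[i + 1]? = some b := by
  induction w with
  | nil => simp [not_adj_nil]
  | cons c l ih =>
    rw [adj_cons, ih]
    constructor
    · rintro (⟨rfl, h⟩ | ⟨i, h⟩)
      · exact ⟨0, by simpa [List.head?_eq_getElem?] using h⟩
      · exact ⟨i + 1, by simpa using h⟩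
    · rintro ⟨i, h1, h2⟩
      cases i with
      | zero => exact Or.inl ⟨by simpa using h1, by simpa [List.head?_eq_getElem?] using h2⟩
      | succ i => exact Or.inr ⟨i, by simpa using h1, by simpa using h2⟩

end Lists

/-! ### Peak-values in terms of runs -/

theorem mem_peakValues {w : List ℕ} (hw : w.Nodup) {v : ℕ} :
    v ∈ peakValues w ↔ ∃ a b, Adj w a v ∧ Adj w v b ∧ a < v ∧ b < v := by
  unfold peakValues
  rw [mem_image]
  constructor
  · rintro ⟨i, hi, rfl⟩
    rw [mem_filter] at hi
    obtain ⟨-, h0, h1, h2, h3⟩ := hi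
    refine ⟨w.getD (i - 1) 0, w.getD (i + 1) 0, adj_iff_getElem?.2 ⟨i - 1, ?_, ?_⟩,
      adj_iff_getElem?.2 ⟨i, ?_, ?_⟩, h2, h3⟩
    · have : i - 1 < w.length := by omega
      simp [List.getD, this]
    · have : i < w.length := by omega
      simp [List.getD, this, Nat.sub_add_cancel h0]
    · have : i < w.length := by omega
      simp [List.getD, this]
    · simp [List.getD, h1]
  · rintro ⟨a, b, h1, h2, hav, hbv⟩
    obtain ⟨i, hi, hi'⟩ := adj_iff_getElem?.1 h1
    obtain ⟨j, hj, hj'⟩ := adj_iff_getElem?.1 h2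
    obtain ⟨li, ei⟩ := List.getElem?_eq_some_iff.1 hi'
    obtain ⟨lj, ej⟩ := List.getElem?_eq_some_iff.1 hj
    obtain ⟨lj', ej'⟩ := List.getElem?_eq_some_iff.1 hj'
    have hij : i + 1 = j := (hw.getElem_inj_iff).1 (ei.trans ej.symm)
    subst hij
    refine ⟨i + 1, mem_filter.2 ⟨mem_range.2 li, Nat.succ_pos _, lj', ?_, ?_⟩, ?_⟩
    · rw [Nat.add_sub_cancel]
      simpa [List.getD, hi, hi'] using hav
    · simpa [List.getD, hj, hj'] using hbv
    · simp [List.getD, hi']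

/-- A list of nonempty increasing words without common letters. -/
structure IsRunList (G : List (List ℕ)) : Prop where
  nil_notMem : [] ∉ G
  lt : ∀ A ∈ G, ∀ a b, Adj A a b → a < b
  nodup : G.flatten.Nodup

namespace IsRunList

variable {G : List (List ℕ)}

theorem nodup_of_mem (hG : IsRunList G) {A : List ℕ} (hA : A ∈ G) : A.Nodup :=
  (List.nodup_flatten.1 hG.nodup).1 A hA

theorem eq_of_mem (hG : IsRunList G) {A B : List ℕ} (hA : A ∈ G) (hB : B ∈ G) {a : ℕ}
    (h1 : a ∈ A) (h2 : a ∈ B) : A = B := by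
  by_contra h
  have : Std.Symm (List.Disjoint (α := ℕ)) := ⟨fun _ _ h => h.symm⟩
  exact (List.Pairwise.forall (List.nodup_flatten.1 hG.nodup).2 hA hB h) h1 h2

theorem exists_head (hG : IsRunList G) {A : List ℕ} (hA : A ∈ G) : ∃ s, A.head? = some s := by
  cases A with
  | nil => exact absurd hA hG.nil_notMem
  | cons s A => exact ⟨s, rfl⟩

/-- Disjoint runs have distinct starts, so the order compares starts. The run behind `A` has the
least start above that of `A`; hence `v` precedes a descent iff some larger start is below `v`. -/
theorem mem_peakValues_of_sorted (hG : IsRunList G) (hs : G.Pairwise (· ≤ ·)) {v : ℕ} :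
    v ∈ peakValues G.flatten ↔ ∃ A ∈ G, A.getLast? = some v ∧ ∃ s, A.head? = some s ∧
      ∃ B ∈ G, ∃ s', B.head? = some s' ∧ s < s' ∧ s' < v := by
  have hle : ∀ A B : List ℕ, A ≤ B → ∀ s s', A.head? = some s → B.head? = some s' → s ≤ s' := by
    intro A B h s s' h1 h2
    cases A with
    | nil => simp at h1
    | cons a A =>
      cases B with
      | nil => simp at h2
      | cons b B =>
        simp only [List.head?_cons, Option.some.injEq] at h1 h2
        by_contra hss
        exact (not_lt.2 h) (List.Lex.rel (by omega))
  rw [mem_peakValues hG.nodup]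
  constructor
  · rintro ⟨a, b, h1, h2, hav, hbv⟩
    rcases (adj_flatten hG.nil_notMem).1 h2 with ⟨A, hA, h3⟩ | ⟨A, B, hAB, h3, h4⟩
    · have := hG.lt A hA _ _ h3
      omega
    · have hA := hAB.mem_left
      have hB := hAB.mem_right
      obtain ⟨s, h5⟩ := hG.exists_head hA
      refine ⟨A, hA, h3, s, h5, B, hB, b, h4, lt_of_le_of_ne ?_ ?_, hbv⟩
      · exact hle A B (List.pairwise_iff_forall_sublist.1 hs hAB.sublist) _ _ h5 h4
      · rintro rfl
        have hd := List.pairwise_iff_forall_sublist.1 (List.nodup_flatten.1 hG.nodup).2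
          hAB.sublist
        exact hd (List.mem_of_head? h5) (List.mem_of_head? h4)
  · rintro ⟨A, hA, hv, s, h1, B, hB, s', h2, hss, hsv⟩
    have hne : A.head? ≠ some v := by
      rw [h1]
      intro h
      have := Option.some.inj h
      omega
    obtain ⟨a, ha⟩ := exists_adj_left (List.mem_of_getLast? hv) hne
    obtain ⟨L, M, rfl⟩ := List.append_of_mem hA
    have hBM : B ∈ M := by
      rcases List.mem_append.1 hB with h | h
      · have h3 := (List.pairwise_append.1 hs).2.2 B h A (by simp)
        have := hle B A h3 _ _ h2 h1
        omega
      · rcases List.mem_cons.1 h with h | h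
        · rw [h, h1] at h2
          have := Option.some.inj h2
          omega
        · exact h
    cases M with
    | nil => simp at hBM
    | cons C M =>
      have hC : C ∈ L ++ A :: C :: M := by simp
      obtain ⟨b, hb⟩ := hG.exists_head hC
      have hCB : b ≤ s' := by
        rcases List.mem_cons.1 hBM with h | h
        · rw [h, hb] at h2
          exact (Option.some.inj h2).le
        · have h3 := (List.pairwise_append.1 hs).2.1
          rw [List.pairwise_cons, List.pairwise_cons] at h3
          exact hle C B (h3.2.1 B h) _ _ hb h2
      refine ⟨a, b, (adj_flatten hG.nil_notMem).2 (Or.inl ⟨A, hA, ha⟩),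
        (adj_flatten hG.nil_notMem).2 (Or.inr ⟨A, C, ⟨L, M, by simp⟩, hv, hb⟩),
        hG.lt A hA _ _ ha, by omega⟩

end IsRunList

theorem isRunList_runs {w : List ℕ} (hw : w.Nodup) : IsRunList (runs w) := by
  have hf : (runs w).flatten = w := List.flatten_splitBy _ _
  have hn : (runs w).flatten.Nodup := by rwa [hf]
  refine ⟨List.nil_notMem_splitBy _ _, fun A hA a b hab => ?_, hn⟩
  have h1 := rel_of_isChain_of_adj (List.isChain_of_mem_splitBy hA) hab
  simp only [decide_eq_true_eq] at h1
  refine lt_of_le_of_ne h1 ?_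
  rintro rfl
  have hA' := (List.nodup_flatten.1 hn).1 A hA
  have := hab.sublist.nodup hA'
  simp at this

theorem isRunList_sorted_runs {w : List ℕ} (hw : w.Nodup) :
    IsRunList ((runs w).insertionSort (· ≤ ·)) := by
  have h := isRunList_runs hw
  have hp := (runs w).perm_insertionSort (· ≤ ·)
  refine ⟨fun h' => h.nil_notMem (hp.mem_iff.1 h'), fun A hA => h.lt A (hp.mem_iff.1 hA), ?_⟩
  exact hp.flatten.nodup_iff.2 h.nodup

theorem mem_peakValues_runsort {w : List ℕ} (hw : w.Nodup) {v : ℕ} :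
    v ∈ peakValues (runsort w) ↔ ∃ A ∈ runs w, A.getLast? = some v ∧ ∃ s, A.head? = some s ∧
      ∃ B ∈ runs w, ∃ s', B.head? = some s' ∧ s < s' ∧ s' < v := by
  unfold runsort
  rw [(isRunList_sorted_runs hw).mem_peakValues_of_sorted (List.pairwise_insertionSort _ _)]
  simp only [((runs w).perm_insertionSort (· ≤ ·)).mem_iff]

theorem mem_runStarts {w : List ℕ} {v : ℕ} :
    v ∈ runStarts w ↔ ∃ A ∈ runs w, A.head? = some v := by
  simp [runStarts]

/-- Boundaries between consecutive runs are descents, so the ascents are the adjacencies inside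
runs. -/
theorem adj_and_lt_iff {w : List ℕ} (hw : w.Nodup) {a b : ℕ} :
    a < b ∧ Adj w a b ↔ ∃ A ∈ runs w, Adj A a b := by
  have hG := isRunList_runs hw
  have hf : (runs w).flatten = w := List.flatten_splitBy _ _
  have key := adj_flatten hG.nil_notMem (a := a) (b := b)
  rw [hf] at key
  rw [key]
  constructor
  · rintro ⟨hab, h | ⟨A, B, hAB, h1, h2⟩⟩
    · exact h
    · obtain ⟨hA, hB, h3⟩ := rel_of_isChain_of_adj (List.isChain_getLast_head_splitBy _ w) hAB
      rw [List.getLast?_eq_some_getLast hA] at h1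
      rw [List.head?_eq_some_head hB] at h2
      rw [Option.some.inj h1, Option.some.inj h2] at h3
      simp only [decide_eq_false_iff_not] at h3
      omega
  · rintro ⟨A, hA, h⟩
    exact ⟨hG.lt A hA _ _ h, Or.inl ⟨A, hA, h⟩⟩

/-! ### Run-starts and peaks through ascent predecessors -/

section Statistics

variable {n : ℕ} {w : List ℕ}

theorem mem_runs_of_mem {v : ℕ} : v ∈ w ↔ ∃ A ∈ runs w, v ∈ A := by
  have hf : (runs w).flatten = w := List.flatten_splitBy _ _
  rw [← List.mem_flatten, hf]

theorem ascPred_eq_iff_adj_runs (hw : w.Nodup) {a b : ℕ} (ha : a ≠ 0) :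
    ascPred w b = a ↔ ∃ A ∈ runs w, Adj A a b := by
  rw [ascPred_eq_iff hw ha, adj_and_lt_iff hw]

theorem ascPred_eq_zero_iff (hw : w ∈ words n) {A : List ℕ} (hA : A ∈ runs w) {v : ℕ}
    (hv : v ∈ A) : ascPred w v = 0 ↔ A.head? = some v := by
  have hw' := mem_words.1 hw
  have hG := isRunList_runs hw'.1
  constructor
  · intro h
    by_contra h0
    obtain ⟨a, ha⟩ := exists_adj_left hv h0
    have ha0 : a ≠ 0 := by
      have := (hw'.2 a).1 (mem_runs_of_mem.2 ⟨A, hA, ha.mem_left⟩)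
      omega
    have := (ascPred_eq_iff_adj_runs hw'.1 ha0).2 ⟨A, hA, ha⟩
    exact ha0 (this.symm.trans h)
  · intro h
    by_contra h0
    obtain ⟨B, hB, h1⟩ := (ascPred_eq_iff_adj_runs hw'.1 h0).1 rfl
    have := hG.eq_of_mem hA hB hv h1.mem_right
    subst this
    exact h1.head?_ne (hG.nodup_of_mem hA) h

theorem mem_runStarts_iff (hw : w ∈ words n) {v : ℕ} :
    v ∈ runStarts w ↔ v ∈ Icc 1 n ∧ ascPred w v = 0 := by
  rw [mem_runStarts, mem_Icc, ← (mem_words.1 hw).2]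
  constructor
  · rintro ⟨A, hA, h⟩
    have hv := List.mem_of_head? h
    exact ⟨mem_runs_of_mem.2 ⟨A, hA, hv⟩, (ascPred_eq_zero_iff hw hA hv).2 h⟩
  · rintro ⟨h, h0⟩
    obtain ⟨A, hA, hv⟩ := mem_runs_of_mem.1 h
    exact ⟨A, hA, (ascPred_eq_zero_iff hw hA hv).1 h0⟩

theorem mem_peakValues_iff (hn : 1 ≤ n) (hw : w ∈ words n) {v : ℕ} :
    v ∈ peakValues w ↔ v ∈ Icc 1 n ∧ ascPred w v ≠ 0 ∧ Closed (ascPred w) {lastLetter w} v := by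
  have hw' := mem_words.1 hw
  rw [mem_peakValues hw'.1, mem_Icc, ← hw'.2]
  have hne := ne_nil_of_mem_words hn hw
  have hlast : w.getLast? = some (lastLetter w) := by
    rw [lastLetter_eq_getLast hne, List.getLast?_eq_some_getLast hne]
  unfold Closed
  rw [mem_singleton]
  constructor
  · rintro ⟨a, b, h1, h2, hav, hbv⟩
    have ha0 : a ≠ 0 := by
      have := (hw'.2 a).1 h1.mem_left
      omega
    refine ⟨h1.mem_right, ?_, ?_, ?_⟩
    · rw [(ascPred_eq_iff hw'.1 ha0).2 ⟨hav, h1⟩]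
      exact ha0
    · rintro rfl
      exact h2.getLast?_ne hw'.1 hlast
    · intro c hc
      have h3 := (ascPred_eq_iff hw'.1 (by omega)).1 hc
      have := h3.2.right_unique hw'.1 h2
      omega
  · rintro ⟨hv, h0, h1, h2⟩
    obtain ⟨h3, h4⟩ := ascPred_spec h0
    obtain ⟨b, hb⟩ := exists_adj_right hv (by
      rw [hlast]
      exact fun h => h1 (Option.some.inj h).symm)
    refine ⟨_, b, h4, hb, h3, ?_⟩
    by_contra hvb
    rcases eq_or_lt_of_le (not_lt.1 hvb) with rfl | hlt
    · have := hb.sublist.nodup hw'.1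
      simp at this
    · have hv1 := (hw'.2 v).1 hv
      exact h2 b ((ascPred_eq_iff hw'.1 (by omega)).2 ⟨hlt, hb⟩)

end Statistics


/-! ### Run heads and the latest run -/

/-- The first letter of the run containing the letter `b`. -/
def runHead (r : ℕ → ℕ) (b : ℕ) : ℕ :=
  if _h : r b ≠ 0 ∧ r b < b then runHead r (r b) else b
termination_by b
decreasing_by exact _h.2

section RunHead

variable {n : ℕ} {r : ℕ → ℕ}

theorem runHead_of_eq_zero {b : ℕ} (h : r b = 0) : runHead r b = b := by
  rw [runHead]
  simp [h]

theorem runHead_of_ne_zero (hr : IsPred n r) {b : ℕ} (h : r b ≠ 0) :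
    runHead r b = runHead r (r b) := by
  rw [runHead, dif_pos ⟨h, hr.lt b h⟩]

theorem runHead_spec (hr : IsPred n r) (b : ℕ) :
    r (runHead r b) = 0 ∧ runHead r b ≤ b ∧ (1 ≤ b → 1 ≤ runHead r b) := by
  induction b using Nat.strong_induction_on with
  | _ b ih =>
    by_cases h : r b = 0
    · rw [runHead_of_eq_zero h]
      exact ⟨h, le_rfl, id⟩
    · have hlt := hr.lt b h
      obtain ⟨h1, h2, h3⟩ := ih _ hlt
      rw [runHead_of_ne_zero hr h]
      exact ⟨h1, by omega, fun _ => h3 (by omega)⟩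

theorem exists_pred_eq_of_runHead_eq (hr : IsPred n r)
    (hinj : ∀ b c, r b ≠ 0 → r b = r c → b = c) {a b : ℕ} (ha : 1 ≤ a)
    (h : runHead r a = runHead r b) (hab : a < b) : ∃ c ≤ b, r c = a := by
  induction b using Nat.strong_induction_on generalizing a with
  | _ b ih =>
    have hb : r b ≠ 0 := by
      intro h0
      rw [runHead_of_eq_zero h0] at h
      have := (runHead_spec hr a).2.1
      omega
    have hlt := hr.lt b hb
    have hh := runHead_of_ne_zero hr hb
    rcases lt_trichotomy a (r b) with h1 | h1 | h1
    · obtain ⟨c, hc, hc'⟩ := ih _ hlt ha (h.trans hh) h1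
      exact ⟨c, by omega, hc'⟩
    · exact ⟨b, le_rfl, h1.symm⟩
    -- Here `r b < a < b`: induction at `a` gives `r b` a successor `c ≤ a`, whereas injectivity
    -- forces `c = b`.
    · obtain ⟨c, hc, hc'⟩ := ih a hab (Nat.one_le_iff_ne_zero.2 hb) (hh.symm.trans h.symm) h1
      have := hinj b c hb hc'.symm
      omega

/-- Invariants of the scan defining `tip`: its run has the largest start so far, and it is the
largest letter so far in that run. -/
theorem tip_spec (hr : IsPred n r) (hinj : ∀ b c, r b ≠ 0 → r b = r c → b = c) (v : ℕ) :
    1 ≤ tip r (v + 1) ∧ (∀ s, 1 ≤ s → s ≤ v + 1 → r s = 0 → s ≤ runHead r (tip r (v + 1))) ∧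
      ∀ a, 1 ≤ a → a ≤ v + 1 → runHead r a = runHead r (tip r (v + 1)) → a ≤ tip r (v + 1) := by
  induction v with
  | zero =>
    have h1 : r 1 = 0 := by
      by_contra h
      have := hr.lt 1 h
      omega
    have ht : tip r (0 + 1) = 1 := by simp [tip, h1]
    rw [ht, runHead_of_eq_zero h1]
    exact ⟨le_rfl, fun s _ hs _ => hs, fun a _ ha _ => ha⟩
  | succ v ih =>
    obtain ⟨ih0, ih1, ih2⟩ := ih
    by_cases h0 : r (v + 1 + 1) = 0
    · have ht : tip r (v + 1 + 1) = v + 1 + 1 := by rw [tip, if_pos (Or.inl h0)]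
      rw [ht, runHead_of_eq_zero h0]
      exact ⟨by omega, fun s _ hs _ => hs, fun a _ ha _ => ha⟩
    · by_cases h1 : r (v + 1 + 1) = tip r (v + 1)
      · have ht : tip r (v + 1 + 1) = v + 1 + 1 := by rw [tip, if_pos (Or.inr h1)]
        rw [ht, runHead_of_ne_zero hr h0, h1]
        refine ⟨by omega, fun s hs1 hs hs0 => ?_, fun a _ ha _ => ha⟩
        have : s ≠ v + 1 + 1 := by
          rintro rfl
          exact h0 hs0
        exact ih1 s hs1 (by omega) hs0
      · have ht : tip r (v + 1 + 1) = tip r (v + 1) := by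
          rw [tip, if_neg (by simp only [h0, h1, or_self, not_false_eq_true])]
        rw [ht]
        refine ⟨ih0, fun s hs1 hs hs0 => ?_, fun a ha1 ha hah => ?_⟩
        · have : s ≠ v + 1 + 1 := by
            rintro rfl
            exact h0 hs0
          exact ih1 s hs1 (by omega) hs0
        · rcases Nat.lt_or_ge a (v + 1 + 1) with hlt | hge
          · exact ih2 a ha1 (by omega) hah
          -- The new letter cannot belong to the run of the tip: its predecessor, being below the
          -- tip, would already have a successor there.
          · have hav : a = v + 1 + 1 := by omega
            subst hav
            rw [runHead_of_ne_zero hr h0] at hah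
            have hlt := hr.lt _ h0
            have hle := ih2 _ (Nat.one_le_iff_ne_zero.2 h0) (by omega) hah
            have htl := tip_le r (v + 1)
            obtain ⟨c, hc, hc'⟩ := exists_pred_eq_of_runHead_eq hr hinj
              (Nat.one_le_iff_ne_zero.2 h0) hah (lt_of_le_of_ne hle h1)
            have := hinj _ _ h0 hc'.symm
            omega

theorem notLatest_iff (hr : IsPred n r) (hinj : ∀ b c, r b ≠ 0 → r b = r c → b = c) {v : ℕ}
    (hv : r v ≠ 0) :
    NotLatest r v ↔ ∃ s, 1 ≤ s ∧ r s = 0 ∧ runHead r v < s ∧ s < v := by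
  have hlt := hr.lt v hv
  obtain ⟨k, rfl⟩ : ∃ k, v = k + 1 + 1 := ⟨v - 2, by omega⟩
  obtain ⟨h0, h1, h2⟩ := tip_spec hr hinj k
  have htl := tip_le r (k + 1)
  have hp : 1 ≤ r (k + 1 + 1) := Nat.one_le_iff_ne_zero.2 hv
  unfold NotLatest
  rw [Nat.add_sub_cancel, runHead_of_ne_zero hr hv]
  constructor
  · intro hne
    -- The witness is the start of the latest run.
    obtain ⟨h3, h4, h5⟩ := runHead_spec hr (tip r (k + 1))
    refine ⟨_, h5 h0, h3, lt_of_le_of_ne ?_ ?_, by omega⟩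
    · obtain ⟨h6, h7, h8⟩ := runHead_spec hr (r (k + 1 + 1))
      exact h1 _ (h8 hp) (by omega) h6
    · intro heq
      have hle := h2 _ hp (by omega) heq
      obtain ⟨c, hc, hc'⟩ := exists_pred_eq_of_runHead_eq hr hinj hp heq (lt_of_le_of_ne hle hne)
      have := hinj _ _ hv hc'.symm
      omega
  · rintro ⟨s, hs1, hs0, h3, h4⟩ heq
    have := h1 s hs1 (by omega) hs0
    rw [heq] at h3
    omega

end RunHead

/-! ### Peaks after run-sorting -/

section Sorted

variable {n : ℕ} {w : List ℕ}

theorem ascPred_injective (hw : w ∈ words n) :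
    ∀ b c, ascPred w b ≠ 0 → ascPred w b = ascPred w c → b = c := by
  intro b c hb h
  have h1 := (ascPred_spec hb).2
  rw [h] at hb
  have h2 := (ascPred_spec hb).2
  rw [h] at h1
  exact h1.right_unique (mem_words.1 hw).1 h2

theorem head?_eq_runHead (hw : w ∈ words n) {A : List ℕ} (hA : A ∈ runs w) {v : ℕ} :
    v ∈ A → A.head? = some (runHead (ascPred w) v) := by
  have hw' := mem_words.1 hw
  have hr := isPred_ascPred hw
  induction v using Nat.strong_induction_on with
  | _ v ih =>
    intro hv
    by_cases h : ascPred w v = 0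
    · rw [runHead_of_eq_zero h]
      exact (ascPred_eq_zero_iff hw hA hv).1 h
    · obtain ⟨B, hB, h1⟩ := (ascPred_eq_iff_adj_runs hw'.1 h).1 rfl
      have := (isRunList_runs hw'.1).eq_of_mem hA hB hv h1.mem_right
      subst this
      rw [runHead_of_ne_zero hr h]
      exact ih _ (hr.lt v h) h1.mem_left

theorem closed_empty_iff (hw : w ∈ words n) {A : List ℕ} (hA : A ∈ runs w) {v : ℕ}
    (hv : v ∈ A) : Closed (ascPred w) ∅ v ↔ A.getLast? = some v := by
  have hw' := mem_words.1 hw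
  have hv0 : v ≠ 0 := by
    have := (hw'.2 v).1 (mem_runs_of_mem.2 ⟨A, hA, hv⟩)
    omega
  unfold Closed
  constructor
  · rintro ⟨-, h⟩
    by_contra hne
    obtain ⟨b, hb⟩ := exists_adj_right hv hne
    exact h b ((ascPred_eq_iff_adj_runs hw'.1 hv0).2 ⟨A, hA, hb⟩)
  · intro h
    refine ⟨notMem_empty _, fun b hb => ?_⟩
    obtain ⟨B, hB, h1⟩ := (ascPred_eq_iff_adj_runs hw'.1 hv0).1 hb
    have hG := isRunList_runs hw'.1
    have := hG.eq_of_mem hA hB hv h1.mem_left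
    subst this
    exact h1.getLast?_ne (hG.nodup_of_mem hA) h

theorem mem_peakValues_runsort_iff (hw : w ∈ words n) {v : ℕ} :
    v ∈ peakValues (runsort w) ↔ v ∈ Icc 1 n ∧ ascPred w v ≠ 0 ∧ Closed (ascPred w) ∅ v ∧
      NotLatest (ascPred w) v := by
  have hw' := mem_words.1 hw
  have hr := isPred_ascPred hw
  have hinj := ascPred_injective hw
  rw [mem_peakValues_runsort hw'.1, mem_Icc, ← hw'.2]
  constructor
  · rintro ⟨A, hA, hv, s, hs, B, hB, s', hs', h1, h2⟩
    have hvA := List.mem_of_getLast? hv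
    have h0 : ascPred w v ≠ 0 := by
      intro h
      have h3 := (ascPred_eq_zero_iff hw hA hvA).1 h
      rw [hs] at h3
      have := Option.some.inj h3
      omega
    refine ⟨mem_runs_of_mem.2 ⟨A, hA, hvA⟩, h0, (closed_empty_iff hw hA hvA).2 hv,
      (notLatest_iff hr hinj h0).2 ⟨s', ?_, ?_, ?_, h2⟩⟩
    · exact ((hw'.2 s').1 (mem_runs_of_mem.2 ⟨B, hB, List.mem_of_head? hs'⟩)).1
    · exact (ascPred_eq_zero_iff hw hB (List.mem_of_head? hs')).2 hs'
    · have h3 := head?_eq_runHead hw hA hvA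
      rw [hs] at h3
      rw [← Option.some.inj h3]
      exact h1
  · rintro ⟨hv, h0, hc, hl⟩
    obtain ⟨A, hA, hvA⟩ := mem_runs_of_mem.1 hv
    obtain ⟨s', h1, h2, h3, h4⟩ := (notLatest_iff hr hinj h0).1 hl
    have hs' : s' ∈ w := by
      have := (hw'.2 v).1 hv
      exact (hw'.2 s').2 (by omega)
    obtain ⟨B, hB, hs'B⟩ := mem_runs_of_mem.1 hs'
    exact ⟨A, hA, (closed_empty_iff hw hA hvA).1 hc, _, head?_eq_runHead hw hA hvA, B, hB, s',
      (ascPred_eq_zero_iff hw hB hs'B).1 h2, h3, h4⟩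

end Sorted

/-! ### Equidistribution -/

section Main

variable {R : Type*} [CommSemiring R] (x y : ℕ → R)

theorem weight_eq_setProd {c : (ℕ → ℕ) → ℕ → Prop} {n : ℕ} {r : ℕ → ℕ} {U S P : Finset ℕ}
    (hS : ∀ v, v ∈ S ↔ v ∈ Icc 1 n ∧ cut r U v = 0)
    (hP : ∀ v, v ∈ P ↔ v ∈ Icc 1 n ∧ cut r U v ≠ 0 ∧ Closed r U v ∧ c (cut r U) v) :
    weight x y c n r U = setProd x S * setProd y P := by
  classical
  have h1 : S = (Icc 1 n).filter fun v => cut r U v = 0 := by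
    ext v
    rw [hS, mem_filter]
  have h2 : P = (Icc 1 n).filter fun v =>
      cut r U v ≠ 0 ∧ Closed r U v ∧ c (cut r U) v := by
    ext v
    rw [hP, mem_filter]
  rw [setProd, setProd, h1, h2, prod_filter, prod_filter, ← prod_mul_distrib, weight]
  refine prod_congr rfl fun v _ => ?_
  unfold letterWeight
  by_cases h : cut r U v = 0
  · simp [h]
  · simp [h]

/-- Nothing follows the last letter, so declaring it open cuts nothing. -/
theorem cut_lastLetter {n : ℕ} (hn : 1 ≤ n) {w : List ℕ} (hw : w ∈ words n) :
    cut (ascPred w) {lastLetter w} = ascPred w := by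
  funext b
  unfold cut
  have hl := mem_Icc.1 (lastLetter_mem hn hw)
  rw [if_neg]
  rw [mem_singleton]
  intro h
  have h0 : ascPred w b ≠ 0 := by omega
  have h1 := (ascPred_spec h0).2
  rw [h] at h1
  have hne := ne_nil_of_mem_words hn hw
  refine h1.getLast?_ne (mem_words.1 hw).1 ?_
  rw [lastLetter_eq_getLast hne, List.getLast?_eq_some_getLast hne]

theorem cut_empty (r : ℕ → ℕ) : cut r ∅ = r := by
  funext b
  simp [cut]

/-- The pairs `(RS, PKV)` and `(RS, SPV)` are equidistributed. -/
theorem sum_setProd_eq {n : ℕ} (hn : 1 ≤ n) :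
    ∑ π : Equiv.Perm (Fin n), setProd x (RS π) * setProd y (PKV π) =
      ∑ π : Equiv.Perm (Fin n), setProd x (RS π) * setProd y (SPV π) := by
  have h1 := sum_oneLine n fun w => setProd x (runStarts w) * setProd y (peakValues w)
  have h2 := sum_oneLine n fun w => setProd x (runStarts w) * setProd y (peakValues (runsort w))
  refine h1.trans (Eq.trans ?_ h2.symm)
  obtain ⟨k, rfl⟩ : ∃ k, n = k + 1 := ⟨n - 1, by omega⟩
  refine Eq.trans (Eq.trans (sum_congr rfl fun w hw => ?_) ((sum_peak_weight x y k).trans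
    (sum_sorted_weight x y k).symm)) (sum_congr rfl fun w hw => ?_)
  · refine (weight_eq_setProd x y ?_ ?_).symm
    · intro v
      rw [cut_lastLetter hn hw]
      exact mem_runStarts_iff hw
    · intro v
      rw [cut_lastLetter hn hw, mem_peakValues_iff hn hw, and_true]
  · refine weight_eq_setProd x y ?_ ?_
    · intro v
      rw [cut_empty]
      exact mem_runStarts_iff hw
    · intro v
      rw [cut_empty, mem_peakValues_runsort_iff hw]

end Main

end RunSort

theorem mainTheorem1 (n : ℕ) (hn : 1 ≤ n) :
    (∑ π : Equiv.Perm (Fin n),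
        RunSort.setProd (fun i => (MvPolynomial.X (Sum.inl i) : MvPolynomial (ℕ ⊕ ℕ) ℤ))
            (RunSort.RS π) *
          RunSort.setProd (fun i => (MvPolynomial.X (Sum.inr i) : MvPolynomial (ℕ ⊕ ℕ) ℤ))
            (RunSort.PKV π) =
      ∑ π : Equiv.Perm (Fin n),
        RunSort.setProd (fun i => (MvPolynomial.X (Sum.inl i) : MvPolynomial (ℕ ⊕ ℕ) ℤ))
            (RunSort.RS π) *
          RunSort.setProd (fun i => (MvPolynomial.X (Sum.inr i) : MvPolynomial (ℕ ⊕ ℕ) ℤ))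
            (RunSort.SPV π)) ∧
    (∑ σ : Equiv.Perm (Fin n),
        RunSort.setProd (fun i => (MvPolynomial.X i : MvPolynomial ℕ ℤ)) (RunSort.PKV σ) =
      ∑ τ : Equiv.Perm (Fin n),
        RunSort.setProd (fun i => (MvPolynomial.X i : MvPolynomial ℕ ℤ)) (RunSort.SPV τ)) := by
  refine ⟨RunSort.sum_setProd_eq _ _ hn, ?_⟩
  have h := RunSort.sum_setProd_eq (fun _ => (1 : MvPolynomial ℕ ℤ)) MvPolynomial.X hn
  have h1 : ∀ S, RunSort.setProd (fun _ => (1 : MvPolynomial ℕ ℤ)) S = 1 := fun S =>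
    Finset.prod_const_one
  simp only [h1, one_mul] at h
  exact h
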